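/- Let $\mathbb F_q$ be a finite field with $q$ elements and let $k\le n$ and $\beta$ be non-negative integers such that $\beta$ divides $n-k$. For a matrix $\mathbf B=(\mathbf b_1;\dots;\mathbf b_k)\in\mathbb F_q^{k\times n}$ with rows $\mathbf b_i$, the $i$th epipodal vector $\mathbf b_i^+\in\mathbb F_q^n$ is obtained from $\mathbf b_i$ by setting to zero every coordinate in which at least one of $\mathbf b_1,\dots,\mathbf b_{i-1}$ is nonzero; $|\cdot|$ denotes the Hamming weight. *Max Redundant Set.* On input a matrix, scale each nonzero column so that its first nonzero entry is $1$, and return a set of nonzero columns of maximal size whose scaled columns all coincide (ties are broken by an arbitrary rule depending only on the input matrix). *Backward Reduction.* On input a matrix $\mathbf B$, let $\{j_1<\dots<j_t\}$ be the output of Max Redundant Set on $\mathbf B$, and let $m$ be minimal with $B_{m,j_1}\ne0$. For every $i>m$ replace $\mathbf b_i$ by $\mathbf b_i-B_{m,j_1}^{-1}B_{i,j_1}\mathbf b_m$; then move row $m$ to the last position, keeping the order of the other rows. Return the invertible matrix $\mathbf A$ that represents these row operations. *Selective Backward Reduction.* On input $\mathbf B\in\mathbb F_q^{k\times n}$ and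 $\beta$: 1. Let $S$ be the set of indices of the first $k$ linearly independent columns of $\mathbf B$. Fail if no such set exists or if $S\not\subseteq\{1,\dots,k+\beta\}$. 2. Replace $\mathbf B$ by $(\mathbf B|_S)^{-1}\mathbf B$, where $\mathbf B|_S$ is the submatrix of the columns in $S$. Set $j\leftarrow k+2\beta$. 3. For $i=(n-k)/\beta-1,\dots,1$: let $\mathbf A$ be the output of Backward Reduction on the submatrix of the first $i$ rows and first $j$ columns of $\mathbf B$ (all $k$ rows if $i>k$); apply to $\mathbf B$ the row operations $\mathbf A$ on these rows, i.e. $\mathbf B\leftarrow(\mathbf A\oplus\mathbf I)\mathbf B$; set $j\leftarrow j+\beta$. 4. Return $\mathbf B$. **Theorem.** Suppose that $$7\le\beta\le\frac{n-k}{2\log_q(n-k)+1},$$ and let $\varepsilon\in(0,1)$. If Selective Backward Reduction is run on a uniformly random matrix in $\mathbb F_q^{k\times n}$ and $\beta$, then with probability at least $$1-\log_q(\beta)\,2^{1-\beta/20}-\varepsilon$$ it does not fail and its output $(\mathbf b_1;\dots;\mathbf b_k)$ satisfies $|\mathbf b_i^+|\ge2$ for all $1\le i\le k$ with $$i\le 2\log_q\beta-\log_q\bigl(20\log_2(2/\varepsilon)\bigr).$$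 -/

import Mathlib

namespace CodeReduction

variable {F : Type*} [Field F] [DecidableEq F]

/-- The `i`th epipodal vector of `B`: the `i`th row, with the coordinates lying in the support of
an earlier row replaced by `0`. -/
def epipodal {k n : ℕ} (B : Matrix (Fin k) (Fin n) F) (i : Fin k) : Fin n → F :=
  fun c => if ∀ i' : Fin k, i' < i → B i' c = 0 then B i c else 0

/-- The code generated by the rows of `B`. -/
def code {k n : ℕ} (B : Matrix (Fin k) (Fin n) F) : Submodule F (Fin n → F) :=
  Submodule.span F (Set.range B.row)

/-- The support of a code: the coordinates in which some codeword is nonzero. -/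
def codeSupport {n : ℕ} (C : Submodule F (Fin n → F)) : Set (Fin n) :=
  {j | ∃ c ∈ C, c j ≠ 0}

/-- The first row in which column `j` of `B` is nonzero. -/
def leadRow {k n : ℕ} (B : Matrix (Fin k) (Fin n) F) (j : Fin n) (h : ∃ i, B i j ≠ 0) : Fin k :=
  (Finset.univ.filter fun i => B i j ≠ 0).min' (by
    obtain ⟨i, hi⟩ := h
    exact ⟨i, by simpa using hi⟩)

/-- The inverse of the first nonzero entry of column `j` (the value on a zero column is never
used). -/
def colScale {k n : ℕ} (B : Matrix (Fin k) (Fin n) F) (j : Fin n) : F :=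
  if h : ∃ i, B i j ≠ 0 then (B (leadRow B j h) j)⁻¹ else 0

/-- `S` lies in the support of the code generated by `B`, and the columns of `B` indexed by `S`
become equal once each is scaled so that its first nonzero entry is `1`. -/
def HasEqualScaledCols {k n : ℕ} (B : Matrix (Fin k) (Fin n) F) (S : Finset (Fin n)) : Prop :=
  (∀ j ∈ S, j ∈ codeSupport (code B)) ∧
    ∀ j₁ ∈ S, ∀ j₂ ∈ S, ∀ i, colScale B j₁ * B i j₁ = colScale B j₂ * B i j₂

/-- `S` is a possible output of the subroutine Max Redundant Set on input `B`: a set as in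
`HasEqualScaledCols` of maximal size. There may be several such sets. -/
def IsMaxRedundantSet {k n : ℕ} (B : Matrix (Fin k) (Fin n) F) (S : Finset (Fin n)) : Prop :=
  HasEqualScaledCols B S ∧ ∀ T : Finset (Fin n), HasEqualScaledCols B T → T.card ≤ S.card

/-- `sel` implements the subroutine Max Redundant Set: on every input matrix it returns one of
the sets of maximal size, with ties broken in an arbitrary way that depends on the input only. -/
def IsMaxRedundantSetRule (sel : ∀ k n : ℕ, Matrix (Fin k) (Fin n) F → Finset (Fin n)) : Prop :=
  ∀ (k n : ℕ) (B : Matrix (Fin k) (Fin n) F), IsMaxRedundantSet B (sel k n B)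

theorem exists_isMaxRedundantSet {k n : ℕ} (B : Matrix (Fin k) (Fin n) F) :
    ∃ S, IsMaxRedundantSet B S := by
  classical
  obtain ⟨S, hS, hmax⟩ := Finset.exists_max_image
    (Finset.univ.filter fun S : Finset (Fin n) => HasEqualScaledCols B S) Finset.card
    ⟨∅, Finset.mem_filter.2 ⟨Finset.mem_univ _, by simp [HasEqualScaledCols]⟩⟩
  exact ⟨S, (Finset.mem_filter.1 hS).2,
    fun T hT => hmax T (Finset.mem_filter.2 ⟨Finset.mem_univ _, hT⟩)⟩

theorem exists_isMaxRedundantSetRule :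
    ∃ sel : ∀ k n : ℕ, Matrix (Fin k) (Fin n) F → Finset (Fin n), IsMaxRedundantSetRule sel :=
  ⟨fun _ _ B => (exists_isMaxRedundantSet B).choose,
    fun _ _ B => (exists_isMaxRedundantSet B).choose_spec⟩

/-- Subtract `c i` times row `m` from row `i`, for every row `i` below row `m`. -/
def eliminateBelow {k : ℕ} {ι : Type*} (m : Fin k) (c : Fin k → F) (M : Matrix (Fin k) ι F) :
    Matrix (Fin k) ι F :=
  fun i => if m < i then M i - c i • M m else M i

/-- Move row `m` to the last position, keeping the order of the other rows. -/
def moveRowToEnd {k : ℕ} {ι : Type*} (m : Fin k) (M : Matrix (Fin k) ι F) :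
    Matrix (Fin k) ι F :=
  fun i => if i < m then M i else if h : (i : ℕ) + 1 < k then M ⟨i + 1, h⟩ else M m

/-- Backward Reduction, run with the implementation `sel` of Max Redundant Set. The output is the
matrix of the row operations performed, i.e. the result of applying them to the identity.
(A matrix without nonzero column is not a legal input; the identity is returned there.) -/
def backwardReduction (sel : ∀ k n : ℕ, Matrix (Fin k) (Fin n) F → Finset (Fin n))
    {k n : ℕ} (B : Matrix (Fin k) (Fin n) F) : Matrix (Fin k) (Fin k) F :=
  if hS : (sel k n B).Nonempty then
    let j₁ := (sel k n B).min' hS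
    if h : ∃ i, B i j₁ ≠ 0 then
      let m := leadRow B j₁ h
      moveRowToEnd m (eliminateBelow m (fun i => (B m j₁)⁻¹ * B i j₁) 1)
    else 1
  else 1

/-- The first `i` rows and first `j` columns of `B` (all rows if `i` exceeds their number, and
likewise for columns). -/
def corner {k n : ℕ} (i j : ℕ) (B : Matrix (Fin k) (Fin n) F) :
    Matrix (Fin (min i k)) (Fin (min j n)) F :=
  B.submatrix (Fin.castLE (min_le_right i k)) (Fin.castLE (min_le_right j n))

/-- The direct sum of `A` and an identity matrix, of total size `k`. -/
def extendByOne {k i : ℕ} (hi : i ≤ k) (A : Matrix (Fin i) (Fin i) F) :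
    Matrix (Fin k) (Fin k) F :=
  let e : Fin i ⊕ Fin (k - i) ≃ Fin k := finSumFinEquiv.trans (finCongr (Nat.add_sub_cancel' hi))
  Matrix.reindex e e (Matrix.fromBlocks A 0 0 1)

/-- One iteration of the loop: backward reduce the upper left `i × j` corner of `B`, applying the
row operations to the whole of the first `i` rows. -/
def reduceCorner (sel : ∀ k n : ℕ, Matrix (Fin k) (Fin n) F → Finset (Fin n))
    {k n : ℕ} (i j : ℕ) (B : Matrix (Fin k) (Fin n) F) : Matrix (Fin k) (Fin n) F :=
  extendByOne (min_le_right i k) (backwardReduction sel (corner i j B)) * B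

/-- The loop over `i, i - 1, …, 1`, where `j` grows by `β` after every iteration. -/
def reduceLoop (sel : ∀ k n : ℕ, Matrix (Fin k) (Fin n) F → Finset (Fin n))
    {k n : ℕ} (β : ℕ) : (i j : ℕ) → Matrix (Fin k) (Fin n) F → Matrix (Fin k) (Fin n) F
  | 0, _, B => B
  | i + 1, j, B => reduceLoop sel β i (j + β) (reduceCorner sel (i + 1) j B)

open Classical in
/-- The columns that are not linear combinations of earlier columns. If `B` has rank `k`, these
are the first `k` linearly independent columns. -/
noncomputable def pivotCols {k n : ℕ} (B : Matrix (Fin k) (Fin n) F) : Finset (Fin n) :=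
  Finset.univ.filter fun j => B.col j ∉ Submodule.span F (B.col '' {j' | j' < j})

/-- Multiply `B` by the inverse of its square submatrix on the columns `S`. -/
noncomputable def systematize {k n : ℕ} (B : Matrix (Fin k) (Fin n) F) (S : Finset (Fin n))
    (hS : S.card = k) : Matrix (Fin k) (Fin n) F :=
  (B.submatrix id (S.orderEmbOfFin hS))⁻¹ * B

open Classical in
/-- Selective Backward Reduction; the output `none` means that the algorithm fails. -/
noncomputable def selectiveBackwardReduction
    (sel : ∀ k n : ℕ, Matrix (Fin k) (Fin n) F → Finset (Fin n))
    {k n : ℕ} (β : ℕ) (B : Matrix (Fin k) (Fin n) F) : Option (Matrix (Fin k) (Fin n) F) :=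
  if h : (pivotCols B).card = k ∧ ∀ j ∈ pivotCols B, (j : ℕ) < k + β then
    some (reduceLoop sel β ((n - k) / β - 1) (k + 2 * β) (systematize B (pivotCols B) h.1))
  else none

end CodeReduction

/-!
Backward Reduction of a corner with `r + 1` rows leaves the columns chosen by Max Redundant Set
zero above the last row and nonzero in it, and later iterations, which treat fewer rows, keep it
so; hence the epipodal vector of that row has weight at least `2` once two columns of the corner
are equal and nonzero. When the corner is treated, its last `β` columns have not been looked at:
the row operations performed so far are invertible and depend on earlier columns only, so these `β`
columns are still uniform and independent in `F ^ (r + 1)`. By the birthday paradox, the nonzero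
ones among them are pairwise distinct with probability at most
`2 ^ (-β / 20) + 2 ^ (-β ^ 2 / (20 * q ^ (r + 1)))`. The first `k + β` columns fail to span with
probability at most `q ^ (-β)`. In the union bound the second summands are dominated by a geometric
series with sum at most `ε`, and the remaining terms are at most `logb q β * 2 ^ (1 - β / 20)`.
-/

namespace CodeReduction

section Probability

variable {α : Type*}

/-- The probability of the event `s` under `p`, as a real number. -/
noncomputable def prob (p : PMF α) (s : Set α) : ℝ := (p.toOuterMeasure s).toReal

theorem toOuterMeasure_ne_top (p : PMF α) (s : Set α) : p.toOuterMeasure s ≠ ⊤ := by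
  have h_univ : p.toOuterMeasure Set.univ = 1 :=
    (p.toOuterMeasure_apply_eq_one_iff _).2 (Set.subset_univ _)
  exact ne_top_of_le_ne_top (h_univ ▸ ENNReal.one_ne_top)
    (MeasureTheory.measure_mono (Set.subset_univ s))

theorem prob_mono (p : PMF α) {s t : Set α} (h : s ⊆ t) : prob p s ≤ prob p t :=
  ENNReal.toReal_mono (toOuterMeasure_ne_top p t) (MeasureTheory.measure_mono h)

theorem prob_union_le (p : PMF α) (s t : Set α) : prob p (s ∪ t) ≤ prob p s + prob p t :=
  ENNReal.toReal_le_add (MeasureTheory.measure_union_le s t) (toOuterMeasure_ne_top p s)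
    (toOuterMeasure_ne_top p t)

theorem prob_biUnion_finset_le {ι : Type*} (p : PMF α) (I : Finset ι) (s : ι → Set α) :
    prob p (⋃ i ∈ I, s i) ≤ ∑ i ∈ I, prob p (s i) := by
  have h_ne_top : ∀ i ∈ I, p.toOuterMeasure (s i) ≠ ⊤ := fun i _ => toOuterMeasure_ne_top p (s i)
  refine (ENNReal.toReal_mono (ENNReal.sum_ne_top.2 h_ne_top)
    (MeasureTheory.measure_biUnion_finset_le I s)).trans_eq (ENNReal.toReal_sum h_ne_top)

theorem one_sub_prob_le_of_compl_subset (p : PMF α) {s t : Set α} (h : sᶜ ⊆ t) :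
    1 - prob p t ≤ prob p s := by
  have h_univ : prob p Set.univ = 1 := by
    rw [prob, (p.toOuterMeasure_apply_eq_one_iff _).2 (Set.subset_univ _), ENNReal.toReal_one]
  have h_cover : prob p Set.univ ≤ prob p s + prob p t :=
    (prob_mono p fun a _ => or_iff_not_imp_left.2 fun ha => h ha).trans (prob_union_le p s t)
  linarith

theorem prob_map {β : Type*} (f : α → β) (p : PMF α) (s : Set β) :
    prob (p.map f) s = prob p (f ⁻¹' s) := by
  rw [prob, prob, PMF.toOuterMeasure_map_apply]

theorem prob_uniformOfFintype [Fintype α] [Nonempty α] (s : Set α) :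
    prob (PMF.uniformOfFintype α) s = s.ncard / Fintype.card α := by
  classical
  rw [prob, PMF.toOuterMeasure_uniformOfFintype_apply, ENNReal.toReal_div, ENNReal.toReal_natCast,
    ENNReal.toReal_natCast, ← Nat.card_coe_set_eq, Nat.card_eq_fintype_card]

section UniformMap

variable {β : Type*} [Fintype α] [Nonempty α] [Fintype β] [Nonempty β]

theorem map_uniformOfFintype_of_card_fiber {f : α → β} {m : ℕ}
    (h : ∀ b, (f ⁻¹' {b}).ncard = m) :
    (PMF.uniformOfFintype α).map f = PMF.uniformOfFintype β := by
  classical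
  have h_card : Fintype.card α = Fintype.card β * m := by
    rw [← Finset.card_univ, Finset.card_eq_sum_card_fiberwise (f := f) (t := Finset.univ) (by simp),
      ← smul_eq_mul, ← Finset.card_univ, ← Finset.sum_const]
    refine Finset.sum_congr rfl fun b _ => ?_
    rw [← h b, Set.ncard_eq_toFinset_card']
    congr 1
    ext a
    simp
  have hm : m ≠ 0 := by
    rintro rfl
    exact Fintype.card_ne_zero (h_card.trans (mul_zero _))
  ext b
  rw [← PMF.toOuterMeasure_apply_singleton, PMF.toOuterMeasure_map_apply,
    PMF.toOuterMeasure_uniformOfFintype_apply, PMF.uniformOfFintype_apply, h_card,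
    ← Nat.card_eq_fintype_card, Nat.card_coe_set_eq, h b, Nat.cast_mul]
  nth_rw 1 [← one_mul (m : ENNReal)]
  rw [ENNReal.mul_div_mul_right _ _ (by simpa using hm) (by simp), one_div]

theorem map_uniformOfFintype_of_injective {f : α → α} (hf : f.Injective) :
    (PMF.uniformOfFintype α).map f = PMF.uniformOfFintype α := by
  refine map_uniformOfFintype_of_card_fiber (m := 1) fun b => ?_
  obtain ⟨a, rfl⟩ := Finite.surjective_of_injective hf b
  rw [← Set.image_singleton, Set.preimage_image_eq _ hf, Set.ncard_singleton]

theorem map_uniformOfFintype_of_surjective {A C : Type*} [AddGroup A] [Fintype A] [AddGroup C]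
    [Fintype C] (f : A →+ C) (hf : Function.Surjective f) :
    (PMF.uniformOfFintype A).map f = PMF.uniformOfFintype C := by
  classical
  refine map_uniformOfFintype_of_card_fiber (m := (f ⁻¹' {0}).ncard) fun c => ?_
  have h_fiber := AddMonoidHom.card_fiber_eq_of_mem_range f (hf c) (hf 0)
  rw [Set.ncard_eq_toFinset_card', Set.ncard_eq_toFinset_card']
  convert h_fiber using 2 <;> ext <;> simp

end UniformMap

end Probability

section Birthday

theorem ncard_injOn_support_le {ι V : Type*} [Fintype ι] [Zero V] [Fintype V] :
    {v : ι → V | Set.InjOn v (Function.support v)}.ncard ≤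
      ∑ T : Finset ι, (Fintype.card V - 1).descFactorial T.card := by
  classical
  have h_cover : {v : ι → V | Set.InjOn v (Function.support v)} ⊆
      ⋃ T ∈ (Finset.univ : Finset (Finset ι)),
        {v | Set.InjOn v (Function.support v) ∧ ∀ a, a ∈ T ↔ v a ≠ 0} := fun v hv =>
    Set.mem_biUnion (Finset.mem_univ (Finset.univ.filter fun a => v a ≠ 0)) ⟨hv, by simp⟩
  refine (Set.ncard_le_ncard h_cover (Set.toFinite _)).trans <|
    (Finset.set_ncard_biUnion_le _ _).trans <| Finset.sum_le_sum fun T _ => ?_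
  have h_card : Nat.card (T ↪ {x : V // x ≠ 0}) = (Fintype.card V - 1).descFactorial T.card := by
    rw [Nat.card_eq_fintype_card, Fintype.card_embedding_eq, Fintype.card_coe,
      Fintype.card_subtype_compl, Fintype.card_subtype_eq]
  rw [← h_card, ← Nat.card_coe_set_eq]
  let restrict (v : {v : ι → V | Set.InjOn v (Function.support v) ∧ ∀ a, a ∈ T ↔ v a ≠ 0}) :
      T ↪ {x : V // x ≠ 0} :=
    ⟨fun a => ⟨v.1 a, (v.2.2 a).1 a.2⟩, fun a b h =>
      Subtype.ext (v.2.1 ((v.2.2 a).1 a.2) ((v.2.2 b).1 b.2) (congrArg Subtype.val h))⟩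
  refine Nat.card_le_card_of_injective restrict fun v w h => Subtype.ext (funext fun a => ?_)
  by_cases ha : a ∈ T
  · exact congrArg Subtype.val (DFunLike.congr_fun h ⟨a, ha⟩)
  · rw [not_not.1 (mt (v.2.2 a).2 ha), not_not.1 (mt (w.2.2 a).2 ha)]

theorem sub_le_mul_exp_neg_div (m r : ℕ) :
    ((m - r : ℕ) : ℝ) ≤ m * Real.exp (-(r : ℝ) / (m + 1)) := by
  rcases le_total m r with h | h
  · rw [Nat.sub_eq_zero_of_le h, Nat.cast_zero]
    positivity
  · calc ((m - r : ℕ) : ℝ) = m - r := Nat.cast_sub h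
      _ ≤ m - r + r / (m + 1) := le_add_of_nonneg_right (by positivity)
      _ = m * (-(r : ℝ) / (m + 1) + 1) := by field_simp; ring
      _ ≤ m * Real.exp (-(r : ℝ) / (m + 1)) := by gcongr; exact Real.add_one_le_exp _

theorem descFactorial_le_pow_mul_exp (m r : ℕ) :
    (m.descFactorial r : ℝ) ≤ m ^ r * Real.exp (-((r : ℝ) * (r - 1)) / (2 * (m + 1))) := by
  induction r with
  | zero => simp
  | succ r ih =>
    calc ((m.descFactorial (r + 1) : ℕ) : ℝ)
        = ((m - r : ℕ) : ℝ) * m.descFactorial r := by rw [Nat.descFactorial_succ, Nat.cast_mul]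
      _ ≤ m * Real.exp (-(r : ℝ) / (m + 1)) *
          (m ^ r * Real.exp (-((r : ℝ) * (r - 1)) / (2 * (m + 1)))) := by
        gcongr; exact sub_le_mul_exp_neg_div m r
      _ = m ^ (r + 1) * (Real.exp (-(r : ℝ) / (m + 1)) *
          Real.exp (-((r : ℝ) * (r - 1)) / (2 * (m + 1)))) := by ring
      _ = _ := by
        rw [← Real.exp_add]
        congr 2
        push_cast
        field_simp
        ring

theorem three_quarters_pow_mul_two_rpow_le (b : ℕ) :
    (3 / 4 : ℝ) ^ b * 2 ^ ((9 / 25 : ℝ) * b) ≤ 2 ^ (-(b : ℝ) / 20) := by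
  have h_root : (2 : ℝ) ^ (41 / 100 : ℝ) ≤ 4 / 3 := by
    refine le_of_pow_le_pow_left₀ (n := 100) (by norm_num) (by norm_num) ?_
    rw [← Real.rpow_natCast, ← Real.rpow_mul (by norm_num)]
    norm_num
  have h_base : (3 / 4 : ℝ) * 2 ^ (9 / 25 : ℝ) ≤ 2 ^ (-(1 : ℝ) / 20) := by
    calc (3 / 4 : ℝ) * 2 ^ (9 / 25 : ℝ)
        = 3 / 4 * 2 ^ (41 / 100 : ℝ) * 2 ^ (-(1 : ℝ) / 20) := by
          rw [mul_assoc, ← Real.rpow_add (by norm_num)]; norm_num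
      _ ≤ 3 / 4 * (4 / 3) * 2 ^ (-(1 : ℝ) / 20) := by gcongr
      _ = 2 ^ (-(1 : ℝ) / 20) := by ring
  calc (3 / 4 : ℝ) ^ b * 2 ^ ((9 / 25 : ℝ) * b) = (3 / 4 * 2 ^ (9 / 25 : ℝ)) ^ b := by
        rw [mul_pow, ← Real.rpow_mul_natCast (by norm_num)]
    _ ≤ (2 ^ (-(1 : ℝ) / 20)) ^ b := by gcongr
    _ = 2 ^ (-(b : ℝ) / 20) := by
        rw [← Real.rpow_mul_natCast (by norm_num)]
        congr 1
        ring

theorem exp_neg_mul_sub_one_div_le {b r Q : ℝ} (hb : 7 ≤ b) (hr : 9 / 25 * b ≤ r) (hQ : 0 < Q) :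
    Real.exp (-(r * (r - 1)) / (2 * Q)) ≤ 2 ^ (-(b ^ 2) / (20 * Q)) := by
  have h_log : Real.log 2 ≤ 0.694 := by linarith [Real.log_two_lt_d9]
  have h_sq : (0.0694 : ℝ) * b ^ 2 ≤ r * (r - 1) := by nlinarith
  have h_num : Real.log 2 * b ^ 2 ≤ 10 * (r * (r - 1)) := by nlinarith [sq_nonneg b]
  rw [Real.rpow_def_of_pos (by norm_num), Real.exp_le_exp, ← sub_nonneg]
  calc (0 : ℝ) ≤ (10 * (r * (r - 1)) - Real.log 2 * b ^ 2) / (20 * Q) :=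
        div_nonneg (by linarith) (by positivity)
    _ = _ := by field_simp; ring

-- The first term is an exponential Markov bound for supports of at most `9/25 * b` indices, where
-- the birthday estimate behind the second term is too weak. The threshold `9/25` is small enough
-- for `3/4 * 2 ^ (9/25) ≤ 2 ^ (-1/20)` and large enough for `log 2 / 10 ≤ 9/25 * (9/25 - 1/7)`.
theorem descFactorial_le_add {b : ℕ} (hb : 7 ≤ b) (m r : ℕ) :
    (m.descFactorial r : ℝ) ≤ 2 ^ ((9 / 25 : ℝ) * b) * (m / 2 : ℝ) ^ r +
      2 ^ (-((b : ℝ) ^ 2) / (20 * (m + 1))) * (m : ℝ) ^ r := by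
  rcases le_total (r : ℝ) ((9 / 25 : ℝ) * b) with h | h
  · refine le_add_of_le_of_nonneg ?_ (by positivity)
    calc (m.descFactorial r : ℝ) ≤ (m : ℝ) ^ r := mod_cast Nat.descFactorial_le_pow m r
      _ = 2 ^ (r : ℝ) * (m / 2 : ℝ) ^ r := by
        rw [Real.rpow_natCast, ← mul_pow, mul_div_cancel₀ _ two_ne_zero]
      _ ≤ 2 ^ ((9 / 25 : ℝ) * b) * (m / 2 : ℝ) ^ r := by gcongr; norm_num
  · refine le_add_of_nonneg_of_le (by positivity) ?_
    refine (descFactorial_le_pow_mul_exp m r).trans ?_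
    rw [mul_comm]
    gcongr
    exact exp_neg_mul_sub_one_div_le (mod_cast hb) h (by positivity)

theorem sum_descFactorial_le {ι : Type*} [Fintype ι] (hb : 7 ≤ Fintype.card ι) {m : ℕ}
    (hm : 1 ≤ m) :
    ∑ T : Finset ι, (m.descFactorial T.card : ℝ) ≤
      (2 ^ (-(Fintype.card ι : ℝ) / 20) +
        2 ^ (-((Fintype.card ι : ℝ) ^ 2) / (20 * (m + 1)))) * (m + 1 : ℝ) ^ Fintype.card ι := by
  set b := Fintype.card ι
  have h_binomial (x : ℝ) : ∑ T : Finset ι, x ^ T.card = (x + 1) ^ b := by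
    simpa only [one_pow, mul_one] using Fintype.sum_pow_mul_eq_add_pow ι x 1
  have h_half : (m / 2 + 1 : ℝ) ≤ 3 / 4 * (m + 1) := by
    have : (1 : ℝ) ≤ m := mod_cast hm
    linarith
  have h_small : 2 ^ ((9 / 25 : ℝ) * b) * (m / 2 + 1 : ℝ) ^ b ≤
      2 ^ (-(b : ℝ) / 20) * (m + 1 : ℝ) ^ b :=
    calc 2 ^ ((9 / 25 : ℝ) * b) * (m / 2 + 1 : ℝ) ^ b
        ≤ 2 ^ ((9 / 25 : ℝ) * b) * (3 / 4 * (m + 1)) ^ b := by gcongr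
      _ = ((3 / 4) ^ b * 2 ^ ((9 / 25 : ℝ) * b)) * (m + 1 : ℝ) ^ b := by rw [mul_pow]; ring
      _ ≤ 2 ^ (-(b : ℝ) / 20) * (m + 1 : ℝ) ^ b := by
        gcongr; exact three_quarters_pow_mul_two_rpow_le b
  refine (Finset.sum_le_sum fun T _ => descFactorial_le_add hb m T.card).trans ?_
  rw [Finset.sum_add_distrib, ← Finset.mul_sum, ← Finset.mul_sum, h_binomial, h_binomial, add_mul]
  gcongr

theorem prob_injOn_support_le {ι V : Type*} [Fintype ι] [Zero V] [Fintype V] [Nontrivial V]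
    [DecidableEq ι] (hb : 7 ≤ Fintype.card ι) :
    prob (PMF.uniformOfFintype (ι → V)) {v | Set.InjOn v (Function.support v)} ≤
      2 ^ (-(Fintype.card ι : ℝ) / 20) +
        2 ^ (-((Fintype.card ι : ℝ) ^ 2) / (20 * Fintype.card V)) := by
  obtain ⟨m, hm⟩ : ∃ m, Fintype.card V = m + 1 := ⟨_, (Nat.sub_add_cancel Fintype.card_pos).symm⟩
  have hm_pos : 1 ≤ m := by
    have := Fintype.one_lt_card (α := V)
    omega
  have h_count := ncard_injOn_support_le (ι := ι) (V := V)
  rw [hm, Nat.add_sub_cancel, ← Nat.cast_le (α := ℝ)] at h_count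
  rw [prob_uniformOfFintype, Fintype.card_fun, hm, div_le_iff₀ (by positivity)]
  push_cast at h_count ⊢
  exact h_count.trans (sum_descFactorial_le hb hm_pos)

end Birthday

section RandomMatrix

theorem map_uniformOfFintype_submatrix {l m n o R : Type*} [Fintype l] [Fintype m] [Fintype n]
    [Fintype o] [DecidableEq l] [DecidableEq m] [DecidableEq n] [DecidableEq o] [AddGroup R]
    [Fintype R] (r : l ↪ m) (e : o ↪ n) :
    (PMF.uniformOfFintype (Matrix m n R)).map (fun B a x => B (r x) (e a)) =
      PMF.uniformOfFintype (o → l → R) := by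
  let block : Matrix m n R →+ (o → l → R) :=
    { toFun := fun B a x => B (r x) (e a)
      map_zero' := rfl
      map_add' := fun _ _ => rfl }
  refine map_uniformOfFintype_of_surjective block fun w => ?_
  refine ⟨fun i j => Function.extend r (Function.extend e w 0 j) 0 i, ?_⟩
  funext a x
  change Function.extend r (Function.extend e w 0 (e a)) 0 (r x) = w a x
  rw [r.injective.extend_apply, e.injective.extend_apply]

theorem eqOn_col_mul_left {l m n R : Type*} [Fintype m] [NonUnitalNonAssocSemiring R] {S : Set n}
    {B B' : Matrix m n R} (h : Set.EqOn B.col B'.col S) (A : Matrix l m R) :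
    Set.EqOn (A * B).col (A * B').col S := by
  intro j hj
  ext x
  simp only [Matrix.col_apply, Matrix.mul_apply]
  exact Finset.sum_congr rfl fun y _ => congrArg (A x y * ·) (congrFun (h hj) y)

theorem map_uniformOfFintype_mul_of_eqOn {l m n o R : Type*} [Fintype l] [Fintype m] [Fintype n]
    [Fintype o] [DecidableEq l] [DecidableEq m] [DecidableEq n] [DecidableEq o] [CommRing R]
    [Fintype R] {G : Matrix m n R → Matrix m m R} (hG : ∀ B, IsUnit (G B)) {S : Set n}
    (hGS : ∀ B B', Set.EqOn B.col B'.col S → G B = G B') (r : l ↪ m) (e : o ↪ n)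
    (he : ∀ a, e a ∉ S) :
    (PMF.uniformOfFintype (Matrix m n R)).map (fun B a x => (G B * B) (r x) (e a)) =
      PMF.uniformOfFintype (o → l → R) := by
  classical
  -- Multiplying only the columns outside `S` keeps `G B` recoverable from the result.
  let T (B : Matrix m n R) : Matrix m n R := fun x j => if j ∈ S then B x j else (G B * B) x j
  have hT : T.Injective := by
    intro B B' h
    have h_col : Set.EqOn B.col B'.col S := fun j hj => funext fun x => by
      simpa only [T, if_pos hj, Matrix.col_apply] using congrFun (congrFun h x) j
    have h_mul : G B * B = G B * B' := by
      ext x j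
      by_cases hj : j ∈ S
      · exact congrFun (eqOn_col_mul_left h_col (G B) hj) x
      · simpa only [T, if_neg hj, ← hGS B B' h_col] using congrFun (congrFun h x) j
    have h_det := (Matrix.isUnit_iff_isUnit_det _).1 (hG B)
    rw [← Matrix.nonsing_inv_mul_cancel_left _ B h_det, h_mul,
      Matrix.nonsing_inv_mul_cancel_left _ B' h_det]
  rw [← map_uniformOfFintype_submatrix r e]
  conv_rhs => rw [← map_uniformOfFintype_of_injective hT, PMF.map_comp]
  congr 1
  funext B a x
  exact (if_neg (he a)).symm

theorem prob_forall_apply_eq_zero {F V ι : Type*} [Field F] [Fintype F] [AddCommGroup V]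
    [Module F V] [Fintype V] [Fintype ι] [DecidableEq ι] {f : Module.Dual F V} (hf : f ≠ 0) :
    prob (PMF.uniformOfFintype (ι → V)) {v | ∀ a, f (v a) = 0} =
      ((Fintype.card F : ℝ) ^ Fintype.card ι)⁻¹ := by
  have h_map := map_uniformOfFintype_of_surjective (f.compLeft ι).toAddMonoidHom
    (LinearMap.surjective hf).comp_left
  have h_event : {v : ι → V | ∀ a, f (v a) = 0} = (f.compLeft ι).toAddMonoidHom ⁻¹' {0} := by
    ext v
    exact funext_iff.symm
  rw [h_event, ← prob_map, h_map, prob_uniformOfFintype, Set.ncard_singleton, Fintype.card_fun]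
  push_cast
  exact one_div _

theorem prob_span_range_ne_top_le {F V ι : Type*} [Field F] [Fintype F] [AddCommGroup V]
    [Module F V] [Fintype V] [Fintype ι] [DecidableEq ι] :
    prob (PMF.uniformOfFintype (ι → V)) {v | Submodule.span F (Set.range v) ≠ ⊤} ≤
      Fintype.card V / (Fintype.card F : ℝ) ^ Fintype.card ι := by
  classical
  have : Finite (Module.Dual F V) := DFunLike.finite _
  have := Fintype.ofFinite (Module.Dual F V)
  have h_card : Fintype.card (Module.Dual F V) = Fintype.card V := by
    rw [Module.card_eq_pow_finrank (K := F), Subspace.dual_finrank_eq,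
      ← Module.card_eq_pow_finrank]
  have h_cover : {v : ι → V | Submodule.span F (Set.range v) ≠ ⊤} ⊆
      ⋃ f ∈ Finset.univ.filter (fun f : Module.Dual F V => f ≠ 0), {v | ∀ a, f (v a) = 0} := by
    intro v hv
    obtain ⟨f, hf, h_le⟩ := Submodule.exists_le_ker_of_lt_top _ (lt_top_iff_ne_top.2 hv)
    exact Set.mem_biUnion (Finset.mem_filter.2 ⟨Finset.mem_univ f, hf⟩)
      fun a => h_le (Submodule.subset_span ⟨a, rfl⟩)
  refine (prob_mono _ h_cover).trans <| (prob_biUnion_finset_le _ _ _).trans ?_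
  rw [Finset.sum_congr rfl fun f hf => prob_forall_apply_eq_zero (Finset.mem_filter.1 hf).2,
    Finset.sum_const, nsmul_eq_mul, ← div_eq_mul_inv, ← h_card]
  gcongr
  exact Finset.card_le_univ _

end RandomMatrix

section LeadingCols

variable {F : Type*} [Field F] {k n : ℕ}

/-- The first `c` columns of `B` span the whole column space, so that the first `k` linearly
independent columns of `B` exist and are among them. -/
def LeadingColsSpan (c : ℕ) (B : Matrix (Fin k) (Fin n) F) : Prop :=
  Submodule.span F (B.col '' {j | (j : ℕ) < c}) = ⊤

theorem prob_not_leadingColsSpan_le [Fintype F] {β : ℕ} (hn : k + β ≤ n) :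
    prob (PMF.uniformOfFintype (Matrix (Fin k) (Fin n) F)) {B | ¬ LeadingColsSpan (k + β) B} ≤
      ((Fintype.card F : ℝ) ^ β)⁻¹ := by
  let leadingCols (B : Matrix (Fin k) (Fin n) F) : Fin (k + β) → Fin k → F :=
    fun a x => B x (Fin.castLE hn a)
  have h_map := map_uniformOfFintype_submatrix (R := F) (Function.Embedding.refl (Fin k))
    (Fin.castLEEmb hn)
  have h_event : {B : Matrix (Fin k) (Fin n) F | ¬ LeadingColsSpan (k + β) B} =
      leadingCols ⁻¹' {v | Submodule.span F (Set.range v) ≠ ⊤} := by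
    ext B
    rw [Set.mem_ofPred_eq, LeadingColsSpan, ← Fin.range_castLE hn, ← Set.range_comp]
    rfl
  rw [h_event, ← prob_map]
  refine (congrArg (prob · _) h_map).trans_le (prob_span_range_ne_top_le.trans_eq ?_)
  rw [Fintype.card_fun, Fintype.card_fin, Fintype.card_fin, pow_add, Nat.cast_pow,
    ← div_div, div_self (by positivity), one_div]

end LeadingCols

section RowOperations

variable {F : Type*} {k : ℕ} {ι : Type*}

theorem moveRowToEnd_eq_submatrix_cycleIcc (m : Fin (k + 1)) (M : Matrix (Fin (k + 1)) ι F) :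
    moveRowToEnd m M = M.submatrix (Fin.cycleIcc m (Fin.last k)) id := by
  ext i j
  simp only [moveRowToEnd, Matrix.submatrix_apply, id]
  rcases lt_or_ge i m with h_lt | h_ge
  · rw [if_pos h_lt, Fin.cycleIcc_of_lt h_lt]
  rw [if_neg h_ge.not_gt]
  rcases (Fin.le_last i).lt_or_eq with h_last | rfl
  · have h_val : (i : ℕ) < k := h_last
    rw [dif_pos (by omega), Fin.cycleIcc_of_ge_of_lt h_ge h_last]
    congr 1
    exact Fin.ext (Fin.val_add_one_of_lt h_last).symm
  · rw [dif_neg (by simp), Fin.cycleIcc_of_last h_ge]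

theorem moveRowToEnd_apply_eq_zero_iff [Zero F] {m : Fin k} {M : Matrix (Fin k) ι F} {j : ι}
    (h : ∀ i, M i j = 0 ↔ i ≠ m) (x : Fin k) : moveRowToEnd m M x j = 0 ↔ (x : ℕ) + 1 < k := by
  cases k with
  | zero => exact x.elim0
  | succ k =>
    have h_last : Fin.cycleIcc m (Fin.last k) (Fin.last k) = m :=
      Fin.cycleIcc_of_last (Fin.le_last m)
    have h_lt : (x : ℕ) < k ↔ x ≠ Fin.last k := Fin.lt_last_iff_ne_last
    rw [moveRowToEnd_eq_submatrix_cycleIcc, Matrix.submatrix_apply, id, h, Nat.add_lt_add_iff_right,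
      h_lt]
    exact not_congr ⟨fun hx => (Equiv.injective _) (hx.trans h_last.symm), fun hx => hx ▸ h_last⟩

variable [Field F]

theorem isUnit_moveRowToEnd (m : Fin k) {A : Matrix (Fin k) (Fin k) F} (hA : IsUnit A) :
    IsUnit (moveRowToEnd m A) := by
  cases k with
  | zero => exact m.elim0
  | succ k =>
    rw [moveRowToEnd_eq_submatrix_cycleIcc]
    exact (Matrix.isUnit_submatrix_equiv _ (Equiv.refl _)).2 hA

theorem moveRowToEnd_mul (m : Fin k) (A : Matrix (Fin k) (Fin k) F) (M : Matrix (Fin k) ι F) :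
    moveRowToEnd m A * M = moveRowToEnd m (A * M) := by
  ext i j
  simp only [moveRowToEnd, Matrix.mul_apply]
  split_ifs <;> rfl

theorem isUnit_eliminateBelow_one (m : Fin k) (c : Fin k → F) :
    IsUnit (eliminateBelow m c (1 : Matrix (Fin k) (Fin k) F)) := by
  have h_lower : (eliminateBelow m c (1 : Matrix (Fin k) (Fin k) F)).IsLowerTriangular := by
    intro i j (hij : i < j)
    unfold eliminateBelow
    split_ifs with h
    · simp [hij.ne, (h.trans hij).ne]
    · simp [hij.ne]
  have h_diag (i : Fin k) : eliminateBelow m c (1 : Matrix (Fin k) (Fin k) F) i i = 1 := by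
    unfold eliminateBelow
    split_ifs with h
    · simp [h.ne]
    · simp
  rw [Matrix.isUnit_iff_isUnit_det, Matrix.det_of_isLowerTriangular _ h_lower,
    Finset.prod_congr rfl fun i _ => h_diag i, Finset.prod_const_one]
  exact isUnit_one

theorem eliminateBelow_one_mul (m : Fin k) (c : Fin k → F) (M : Matrix (Fin k) ι F) :
    eliminateBelow m c (1 : Matrix (Fin k) (Fin k) F) * M = eliminateBelow m c M := by
  ext i j
  simp only [eliminateBelow, Matrix.mul_apply]
  split_ifs
  · simp [sub_mul, Finset.sum_sub_distrib, Matrix.one_apply]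
  · simp [Matrix.one_apply]

theorem eliminateBelow_apply_of_eq_mul (m : Fin k) (c : Fin k → F) {M : Matrix (Fin k) ι F}
    {a b : ι} {γ : F} (h : ∀ i, M i b = γ * M i a) (i : Fin k) :
    eliminateBelow m c M i b = γ * eliminateBelow m c M i a := by
  unfold eliminateBelow
  split_ifs
  · simp only [Pi.sub_apply, Pi.smul_apply, smul_eq_mul, h]
    ring
  · exact h i

variable {i : ℕ} (hi : i ≤ k)

theorem isUnit_extendByOne {A : Matrix (Fin i) (Fin i) F} (hA : IsUnit A) :
    IsUnit (extendByOne hi A) := by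
  rw [Matrix.isUnit_iff_isUnit_det] at hA ⊢
  rwa [extendByOne, Matrix.det_reindex_self, Matrix.det_fromBlocks_zero₂₁, Matrix.det_one, mul_one]

theorem submatrix_castLE_extendByOne_mul (A : Matrix (Fin i) (Fin i) F) (M : Matrix (Fin k) ι F) :
    (extendByOne hi A * M).submatrix (Fin.castLE hi) id = A * M.submatrix (Fin.castLE hi) id := by
  let e : Fin i ⊕ Fin (k - i) ≃ Fin k := finSumFinEquiv.trans (finCongr (Nat.add_sub_cancel' hi))
  ext x j
  have h_inl (y : Fin i) : Fin.castLE hi y = e (Sum.inl y) := rfl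
  simp only [Matrix.submatrix_apply, id, Matrix.mul_apply, h_inl]
  rw [← e.sum_comp, Fintype.sum_sum_type]
  simp [extendByOne, e]

theorem extendByOne_mul_apply_of_le (A : Matrix (Fin i) (Fin i) F) (M : Matrix (Fin k) ι F)
    {x : Fin k} (hx : i ≤ x) (j : ι) : (extendByOne hi A * M) x j = M x j := by
  let e : Fin i ⊕ Fin (k - i) ≃ Fin k := finSumFinEquiv.trans (finCongr (Nat.add_sub_cancel' hi))
  obtain ⟨z, rfl⟩ : ∃ z : Fin (k - i), x = e (Sum.inr z) :=
    ⟨⟨x - i, Nat.sub_lt_sub_right hx x.2⟩, Fin.ext (by simp [e, hx])⟩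
  rw [Matrix.mul_apply, ← e.sum_comp, Fintype.sum_sum_type]
  simp [extendByOne, e, Matrix.one_apply]

end RowOperations

section RedundantSets

variable {F : Type*} [Field F] {k n : ℕ} {B : Matrix (Fin k) (Fin n) F}

theorem mem_codeSupport_code_iff {j : Fin n} : j ∈ codeSupport (code B) ↔ ∃ i, B i j ≠ 0 := by
  constructor
  · rintro ⟨c, hc, hcj⟩
    by_contra! h
    have h_le : code B ≤ LinearMap.ker (LinearMap.proj (R := F) (φ := fun _ : Fin n => F) j) :=
      Submodule.span_le.2 (Set.range_subset_iff.2 h)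
    exact hcj (h_le hc)
  · rintro ⟨i, hi⟩
    exact ⟨B i, Submodule.subset_span ⟨i, rfl⟩, hi⟩

variable [DecidableEq F]

theorem apply_leadRow_ne_zero {j : Fin n} (h : ∃ i, B i j ≠ 0) : B (leadRow B j h) j ≠ 0 :=
  (Finset.mem_filter.1 (Finset.min'_mem (Finset.univ.filter fun i => B i j ≠ 0) _)).2

theorem apply_eq_zero_of_lt_leadRow {j : Fin n} (h : ∃ i, B i j ≠ 0) {i : Fin k}
    (hi : i < leadRow B j h) : B i j = 0 := by
  by_contra h_ne
  exact hi.not_ge (Finset.min'_le _ i (by simpa using h_ne))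

theorem colScale_ne_zero {j : Fin n} (h : ∃ i, B i j ≠ 0) : colScale B j ≠ 0 := by
  rw [colScale, dif_pos h]
  exact inv_ne_zero (apply_leadRow_ne_zero h)

theorem colScale_eq_of_col_eq {a b : Fin n} (h : B.col a = B.col b) :
    colScale B a = colScale B b := by
  have h_apply (i : Fin k) : B i a = B i b := congrFun h i
  simp only [colScale, leadRow, h_apply]

theorem HasEqualScaledCols.exists_eq_mul {S : Finset (Fin n)} (hS : HasEqualScaledCols B S)
    {a b : Fin n} (ha : a ∈ S) (hb : b ∈ S) : ∃ γ : F, γ ≠ 0 ∧ ∀ i, B i b = γ * B i a := by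
  have h_scale {j : Fin n} (hj : j ∈ S) : colScale B j ≠ 0 :=
    colScale_ne_zero (mem_codeSupport_code_iff.1 (hS.1 j hj))
  refine ⟨(colScale B b)⁻¹ * colScale B a,
    mul_ne_zero (inv_ne_zero (h_scale hb)) (h_scale ha), fun i => ?_⟩
  rw [mul_assoc, hS.2 a ha b hb i, inv_mul_cancel_left₀ (h_scale hb)]

theorem hasEqualScaledCols_of_forall_col_eq {S : Finset (Fin n)} {v : Fin k → F} (hv : v ≠ 0)
    (hS : ∀ j ∈ S, B.col j = v) : HasEqualScaledCols B S := by
  refine ⟨fun j hj => mem_codeSupport_code_iff.2 ?_, fun a ha b hb i => ?_⟩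
  · exact Function.ne_iff.1 ((hS j hj).trans_ne hv)
  · have h_col : B.col a = B.col b := (hS a ha).trans (hS b hb).symm
    exact congrArg₂ (· * ·) (colScale_eq_of_col_eq h_col) (congrFun h_col i)

theorem IsMaxRedundantSet.two_le_card {S : Finset (Fin n)} (hS : IsMaxRedundantSet B S)
    {a b : Fin n} (hab : a ≠ b) (h_eq : B.col a = B.col b) (h_ne : B.col a ≠ 0) :
    2 ≤ S.card := by
  rw [← Finset.card_pair hab]
  refine hS.2 _ (hasEqualScaledCols_of_forall_col_eq h_ne fun j hj => ?_)
  rcases Finset.mem_insert.1 hj with rfl | hj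
  · rfl
  · rw [Finset.mem_singleton.1 hj, h_eq]

end RedundantSets

section BackwardReduction

variable {F : Type*} [Field F] [DecidableEq F] {k n : ℕ}
  {sel : ∀ k n : ℕ, Matrix (Fin k) (Fin n) F → Finset (Fin n)}

theorem isUnit_backwardReduction (B : Matrix (Fin k) (Fin n) F) :
    IsUnit (backwardReduction sel B) := by
  unfold backwardReduction
  split_ifs
  · dsimp only
    split_ifs
    · exact isUnit_moveRowToEnd _ (isUnit_eliminateBelow_one _ _)
    · exact isUnit_one
  · exact isUnit_one

theorem eliminateBelow_leadRow_apply_eq_zero_iff {B : Matrix (Fin k) (Fin n) F} {j : Fin n}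
    (h : ∃ i, B i j ≠ 0) (i : Fin k) :
    eliminateBelow (leadRow B j h) (fun i => (B (leadRow B j h) j)⁻¹ * B i j) B i j = 0 ↔
      i ≠ leadRow B j h := by
  have h_lead := apply_leadRow_ne_zero h
  unfold eliminateBelow
  rcases lt_trichotomy i (leadRow B j h) with h_lt | h_eq | h_gt
  · rw [if_neg h_lt.not_gt]
    exact iff_of_true (apply_eq_zero_of_lt_leadRow h h_lt) h_lt.ne
  · rw [if_neg h_eq.not_gt, h_eq]
    exact iff_of_false h_lead (not_not.2 rfl)
  · rw [if_pos h_gt, Pi.sub_apply, Pi.smul_apply, smul_eq_mul, mul_right_comm,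
      inv_mul_cancel₀ h_lead, one_mul, sub_self]
    exact iff_of_true rfl h_gt.ne'

theorem backwardReduction_mul_apply_eq_zero_iff (hsel : IsMaxRedundantSetRule sel)
    {B : Matrix (Fin k) (Fin n) F} {j : Fin n} (hj : j ∈ sel k n B) (x : Fin k) :
    (backwardReduction sel B * B) x j = 0 ↔ (x : ℕ) + 1 < k := by
  have hS : HasEqualScaledCols B (sel k n B) := (hsel k n B).1
  have h_mem := Finset.min'_mem _ ⟨j, hj⟩
  have h_ne := mem_codeSupport_code_iff.1 (hS.1 _ h_mem)
  obtain ⟨γ, hγ, h_col⟩ := hS.exists_eq_mul h_mem hj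
  rw [backwardReduction, dif_pos ⟨j, hj⟩]
  dsimp only
  rw [dif_pos h_ne, moveRowToEnd_mul, eliminateBelow_one_mul]
  refine moveRowToEnd_apply_eq_zero_iff (fun i => ?_) x
  rw [eliminateBelow_apply_of_eq_mul _ _ h_col, mul_eq_zero, or_iff_right hγ]
  exact eliminateBelow_leadRow_apply_eq_zero_iff h_ne i

end BackwardReduction

section Loop

variable {F : Type*} [Field F] [DecidableEq F] {k n : ℕ}

theorem epipodal_apply_ne_zero_iff {B : Matrix (Fin k) (Fin n) F} {r : Fin k} {c : Fin n} :
    epipodal B r c ≠ 0 ↔ (∀ i < r, B i c = 0) ∧ B r c ≠ 0 :=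
  ite_ne_right_iff

variable {sel : ∀ k n : ℕ, Matrix (Fin k) (Fin n) F → Finset (Fin n)}

theorem corner_reduceCorner (i j : ℕ) (B : Matrix (Fin k) (Fin n) F) :
    corner i j (reduceCorner sel i j B) =
      backwardReduction sel (corner i j B) * corner i j B := by
  have h := submatrix_castLE_extendByOne_mul (min_le_right i k)
    (backwardReduction sel (corner i j B)) B
  ext x y
  exact congrFun (congrFun h x) (Fin.castLE (min_le_right j n) y)

theorem epipodal_reduceCorner_ne_zero_of_le {i : ℕ} {r : Fin k} (hi : i ≤ r) (j : ℕ)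
    {B : Matrix (Fin k) (Fin n) F} {c : Fin n} (h : epipodal B r c ≠ 0) :
    epipodal (reduceCorner sel i j B) r c ≠ 0 := by
  rw [epipodal_apply_ne_zero_iff] at h ⊢
  have h_below {x : Fin k} (hx : i ≤ x) : reduceCorner sel i j B x c = B x c :=
    extendByOne_mul_apply_of_le _ _ _ ((min_le_left i k).trans hx) c
  refine ⟨fun x hx => ?_, (h_below hi).trans_ne h.2⟩
  rcases lt_or_ge (x : ℕ) i with h_lt | h_ge
  · have h_row := submatrix_castLE_extendByOne_mul (min_le_right i k)
      (backwardReduction sel (corner i j B)) B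
    refine (congrFun (congrFun h_row ⟨x, lt_min h_lt x.2⟩) c).trans ?_
    refine Matrix.mul_apply.trans (Finset.sum_eq_zero fun y _ => mul_eq_zero_of_right _ (h.1 _ ?_))
    exact (lt_min_iff.1 y.2).1.trans_le hi
  · rw [h_below h_ge, h.1 x hx]

theorem epipodal_reduceLoop_ne_zero_of_le {β i : ℕ} {r : Fin k} (hi : i ≤ r) (j : ℕ)
    {B : Matrix (Fin k) (Fin n) F} {c : Fin n} (h : epipodal B r c ≠ 0) :
    epipodal (reduceLoop sel β i j B) r c ≠ 0 := by
  induction i generalizing j B with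
  | zero => exact h
  | succ i ih =>
    exact ih (Nat.le_of_succ_le hi) (j + β) (epipodal_reduceCorner_ne_zero_of_le hi j h)

theorem epipodal_reduceCorner_ne_zero_of_mem_sel (hsel : IsMaxRedundantSetRule sel) {j : ℕ}
    {B : Matrix (Fin k) (Fin n) F} {r : Fin k} {c : Fin (min j n)}
    (hc : c ∈ sel _ _ (corner (r + 1) j B)) :
    epipodal (reduceCorner sel (r + 1) j B) r (Fin.castLE (min_le_right j n) c) ≠ 0 := by
  have h_min : min ((r : ℕ) + 1) k = r + 1 := min_eq_left r.2
  have h_zero (x : Fin k) (hx : x ≤ r) :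
      reduceCorner sel (r + 1) j B x (Fin.castLE (min_le_right j n) c) = 0 ↔ x < r := by
    have h := backwardReduction_mul_apply_eq_zero_iff hsel hc ⟨x, by omega⟩
    rw [← corner_reduceCorner] at h
    exact h.trans (by rw [Fin.lt_def]; dsimp only; omega)
  rw [epipodal_apply_ne_zero_iff]
  exact ⟨fun x hx => (h_zero x hx.le).2 hx, fun h => lt_irrefl r ((h_zero r le_rfl).1 h)⟩

theorem card_sel_le_hammingNorm_epipodal (hsel : IsMaxRedundantSetRule sel) (β j : ℕ)
    (B : Matrix (Fin k) (Fin n) F) (r : Fin k) :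
    (sel _ _ (corner (r + 1) j B)).card ≤
      hammingNorm (epipodal (reduceLoop sel β (r + 1) j B) r) := by
  rw [← Finset.card_map (Fin.castLEEmb (min_le_right j n))]
  refine Finset.card_le_card fun _ hc' => ?_
  obtain ⟨c, hc, rfl⟩ := Finset.mem_map.1 hc'
  exact Finset.mem_filter.2 ⟨Finset.mem_univ _, epipodal_reduceLoop_ne_zero_of_le le_rfl _
    (epipodal_reduceCorner_ne_zero_of_mem_sel hsel hc)⟩

end Loop

section Pivots

variable {F : Type*} [Field F] {k n c : ℕ} {B B' : Matrix (Fin k) (Fin n) F}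

theorem mem_pivotCols {j : Fin n} :
    j ∈ pivotCols B ↔ B.col j ∉ Submodule.span F (B.col '' {j' | j' < j}) := by
  simp only [pivotCols, Finset.mem_filter, Finset.mem_univ, true_and]

theorem linearIndepOn_of_forall_notMem_span (S : Finset (Fin n))
    (hS : ∀ j ∈ S, B.col j ∉ Submodule.span F (B.col '' {j' | j' < j})) :
    LinearIndepOn F B.col (S : Set (Fin n)) := by
  induction S using Finset.induction_on_max with
  | empty => simp
  | insert a S ha ih =>
    rw [Finset.coe_insert]
    refine (ih fun j hj => hS j (Finset.mem_insert_of_mem hj)).insert fun h => ?_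
    exact hS a (Finset.mem_insert_self a S) (Submodule.span_mono (Set.image_mono ha) h)

theorem linearIndepOn_pivotCols (B : Matrix (Fin k) (Fin n) F) :
    LinearIndepOn F B.col (pivotCols B : Set (Fin n)) :=
  linearIndepOn_of_forall_notMem_span _ fun _ => mem_pivotCols.1

theorem col_mem_span_pivotCols (B : Matrix (Fin k) (Fin n) F) (j : Fin n) :
    B.col j ∈ Submodule.span F (B.col '' (pivotCols B : Set (Fin n))) := by
  induction j using WellFoundedLT.induction with
  | ind j ih =>
    by_cases hj : j ∈ pivotCols B
    · exact Submodule.subset_span ⟨j, hj, rfl⟩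
    · rw [mem_pivotCols, not_not] at hj
      exact Submodule.span_le.2 (Set.image_subset_iff.2 ih) hj

theorem LeadingColsSpan.lt_of_mem_pivotCols (h : LeadingColsSpan c B) {j : Fin n}
    (hj : j ∈ pivotCols B) : (j : ℕ) < c := by
  by_contra! hc
  have h_mono : B.col '' {j' | (j' : ℕ) < c} ⊆ B.col '' {j' | j' < j} :=
    Set.image_mono fun i (hi : (i : ℕ) < c) => Fin.lt_def.2 (hi.trans_le hc)
  exact mem_pivotCols.1 hj (Submodule.span_mono h_mono (h ▸ Submodule.mem_top))

theorem LeadingColsSpan.card_pivotCols (h : LeadingColsSpan c B) : (pivotCols B).card = k := by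
  have h_span :
      ⊤ ≤ Submodule.span F (Set.range fun j : (pivotCols B : Set (Fin n)) => B.col j) := by
    rw [← Set.image_eq_range, ← h, Submodule.span_le]
    exact Set.image_subset_iff.2 fun j _ => col_mem_span_pivotCols B j
  simpa using
    (Module.finrank_eq_card_basis (Module.Basis.mk (linearIndepOn_pivotCols B) h_span)).symm

theorem isUnit_submatrix_pivotCols (h : (pivotCols B).card = k) :
    IsUnit (B.submatrix id ((pivotCols B).orderEmbOfFin h)) := by
  rw [← Matrix.linearIndependent_cols_iff_isUnit]
  exact (linearIndepOn_pivotCols B).linearIndependent.comp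
    (fun x => ⟨(pivotCols B).orderEmbOfFin h x, Finset.orderEmbOfFin_mem _ h x⟩)
    fun x y hxy => ((pivotCols B).orderEmbOfFin h).injective (congrArg Subtype.val hxy)

theorem leadingColsSpan_iff_of_eqOn (h : Set.EqOn B.col B'.col {j | (j : ℕ) < c}) :
    LeadingColsSpan c B ↔ LeadingColsSpan c B' := by
  rw [LeadingColsSpan, LeadingColsSpan, h.image_eq]

theorem pivotCols_eq_of_eqOn (h : Set.EqOn B.col B'.col {j | (j : ℕ) < c})
    (hB : LeadingColsSpan c B) : pivotCols B = pivotCols B' := by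
  have hB' := (leadingColsSpan_iff_of_eqOn h).1 hB
  ext j
  rcases lt_or_ge (j : ℕ) c with hj | hj
  · have h_lt : Set.EqOn B.col B'.col {j' | j' < j} :=
      h.mono fun i (hi : i < j) => (Fin.lt_def.1 hi).trans hj
    rw [mem_pivotCols, mem_pivotCols, h hj, h_lt.image_eq]
  · exact iff_of_false (fun hm => hj.not_gt (hB.lt_of_mem_pivotCols hm))
      fun hm => hj.not_gt (hB'.lt_of_mem_pivotCols hm)

open Classical in
/-- The row operations that turn the pivot columns of `B` into an identity matrix. If the first `c`
columns do not span, no row operation is performed, so that the result is invertible in every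
case. -/
noncomputable def systematizer (c : ℕ) (B : Matrix (Fin k) (Fin n) F) : Matrix (Fin k) (Fin k) F :=
  if h : LeadingColsSpan c B then
    (B.submatrix id ((pivotCols B).orderEmbOfFin h.card_pivotCols))⁻¹
  else 1

theorem LeadingColsSpan.systematize_eq (h : LeadingColsSpan c B) :
    systematize B (pivotCols B) h.card_pivotCols = systematizer c B * B := by
  rw [systematize, systematizer, dif_pos h]

theorem isUnit_systematizer (c : ℕ) (B : Matrix (Fin k) (Fin n) F) :
    IsUnit (systematizer c B) := by
  unfold systematizer
  split_ifs with h
  · exact Matrix.isUnit_nonsing_inv_iff.2 (isUnit_submatrix_pivotCols h.card_pivotCols)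
  · exact isUnit_one

theorem systematizer_eq_of_eqOn (h : Set.EqOn B.col B'.col {j | (j : ℕ) < c}) :
    systematizer c B = systematizer c B' := by
  by_cases hB : LeadingColsSpan c B
  · have hB' := (leadingColsSpan_iff_of_eqOn h).1 hB
    rw [systematizer, systematizer, dif_pos hB, dif_pos hB']
    congr 1
    ext x y
    have h_mem := Finset.orderEmbOfFin_mem _ hB.card_pivotCols y
    simp only [Matrix.submatrix_apply, ← pivotCols_eq_of_eqOn h hB]
    exact congrFun (h (hB.lt_of_mem_pivotCols h_mem)) x
  · rw [systematizer, systematizer, dif_neg hB, dif_neg (mt (leadingColsSpan_iff_of_eqOn h).2 hB)]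

end Pivots

section LoopOperator

variable {F : Type*} [Field F] [DecidableEq F] {k n : ℕ}
  (sel : ∀ k n : ℕ, Matrix (Fin k) (Fin n) F → Finset (Fin n)) (β i : ℕ)

/-- The row operations performed on `B` by the first `s` of the `i + s` iterations of the loop, if
the first iteration looks at the first `j` columns. -/
def loopOperator : (s j : ℕ) → Matrix (Fin k) (Fin n) F → Matrix (Fin k) (Fin k) F
  | 0, _, _ => 1
  | s + 1, j, B =>
    let A := extendByOne (min_le_right _ k) (backwardReduction sel (corner (i + s + 1) j B))
    loopOperator s (j + β) (A * B) * A

theorem reduceLoop_add (s j : ℕ) (B : Matrix (Fin k) (Fin n) F) :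
    reduceLoop sel β (i + s) j B =
      reduceLoop sel β i (j + s * β) (loopOperator sel β i s j B * B) := by
  induction s generalizing j B with
  | zero => rw [loopOperator, Matrix.one_mul, zero_mul, add_zero, add_zero]
  | succ s ih =>
    have h_step := ih (j + β) (reduceCorner sel (i + s + 1) j B)
    rw [show j + β + s * β = j + (s + 1) * β by ring] at h_step
    rw [loopOperator, Matrix.mul_assoc]
    exact h_step

theorem isUnit_loopOperator (s j : ℕ) (B : Matrix (Fin k) (Fin n) F) :
    IsUnit (loopOperator sel β i s j B) := by
  induction s generalizing j B with
  | zero => exact isUnit_one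
  | succ s ih => exact (ih _ _).mul (isUnit_extendByOne _ (isUnit_backwardReduction _))

theorem loopOperator_eq_of_eqOn {s j c : ℕ} (hj : j + s * β ≤ c + β)
    {B B' : Matrix (Fin k) (Fin n) F} (h : Set.EqOn B.col B'.col {y | (y : ℕ) < c}) :
    loopOperator sel β i s j B = loopOperator sel β i s j B' := by
  induction s generalizing j B B' with
  | zero => rfl
  | succ s ih =>
    rw [add_one_mul] at hj
    have h_corner : corner (i + s + 1) j B = corner (i + s + 1) j B' := by
      ext x y
      have hy : (y : ℕ) < c := (lt_min_iff.1 y.2).1.trans_le (by omega)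
      exact congrFun (h (x := Fin.castLE (min_le_right j n) y) hy) _
    simp only [loopOperator]
    rw [h_corner, ih (by omega) (eqOn_col_mul_left h _)]

/-- The row operations performed on `B` by Selective Backward Reduction until `s` of the `i + s`
iterations of its loop are done. -/
noncomputable def stageOperator (s : ℕ) (B : Matrix (Fin k) (Fin n) F) :
    Matrix (Fin k) (Fin k) F :=
  let A := systematizer (k + β) B
  loopOperator sel β i s (k + 2 * β) (A * B) * A

theorem isUnit_stageOperator (s : ℕ) (B : Matrix (Fin k) (Fin n) F) :
    IsUnit (stageOperator sel β i s B) :=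
  (isUnit_loopOperator sel β i s _ _).mul (isUnit_systematizer _ B)

theorem stageOperator_eq_of_eqOn {s : ℕ} {B B' : Matrix (Fin k) (Fin n) F}
    (h : Set.EqOn B.col B'.col {y | (y : ℕ) < k + (s + 1) * β}) :
    stageOperator sel β i s B = stageOperator sel β i s B' := by
  have h_lead : Set.EqOn B.col B'.col {y | (y : ℕ) < k + β} :=
    h.mono fun y (hy : (y : ℕ) < k + β) =>
      hy.trans_le (Nat.add_le_add_left (Nat.le_mul_of_pos_left _ s.succ_pos) _)
  simp only [stageOperator]
  rw [systematizer_eq_of_eqOn h_lead,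
    loopOperator_eq_of_eqOn sel β i (by linarith) (eqOn_col_mul_left h _)]

/-- The matrix that Selective Backward Reduction returns, after a loop of `t` iterations, unless it
fails. -/
noncomputable def selectiveOutput (t : ℕ) (B : Matrix (Fin k) (Fin n) F) :
    Matrix (Fin k) (Fin n) F :=
  reduceLoop sel β t (k + 2 * β) (systematizer (k + β) B * B)

theorem selectiveOutput_add (s : ℕ) (B : Matrix (Fin k) (Fin n) F) :
    selectiveOutput sel β (i + s) B =
      reduceLoop sel β i (k + (s + 2) * β) (stageOperator sel β i s B * B) := by
  rw [selectiveOutput, reduceLoop_add, stageOperator, Matrix.mul_assoc, add_mul s, add_assoc,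
    add_comm (2 * β)]

theorem LeadingColsSpan.selectiveBackwardReduction_eq_some {B : Matrix (Fin k) (Fin n) F}
    (h : LeadingColsSpan (k + β) B) :
    selectiveBackwardReduction sel β B = some (selectiveOutput sel β ((n - k) / β - 1) B) := by
  rw [selectiveBackwardReduction, dif_pos ⟨h.card_pivotCols, fun j hj => h.lt_of_mem_pivotCols hj⟩,
    h.systematize_eq, selectiveOutput]

end LoopOperator

section FailureProbability

variable {F : Type*} [Field F] [DecidableEq F] {k n : ℕ}
  {sel : ∀ k n : ℕ, Matrix (Fin k) (Fin n) F → Finset (Fin n)}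

theorem two_le_hammingNorm_epipodal_reduceLoop (hsel : IsMaxRedundantSetRule sel) (β : ℕ) {j : ℕ}
    {B : Matrix (Fin k) (Fin n) F} {r : Fin k} {a b : Fin n} (ha : (a : ℕ) < j) (hb : (b : ℕ) < j)
    (hab : a ≠ b) (h_eq : ∀ x ≤ r, B x a = B x b) (h_ne : ∃ x ≤ r, B x a ≠ 0) :
    2 ≤ hammingNorm (epipodal (reduceLoop sel β (r + 1) j B) r) := by
  obtain ⟨x, hx, hxa⟩ := h_ne
  refine (IsMaxRedundantSet.two_le_card (hsel _ _ (corner (r + 1) j B)) (a := ⟨a, lt_min ha a.2⟩)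
    (b := ⟨b, lt_min hb b.2⟩) (fun h => hab (Fin.ext (Fin.mk.inj h)))
    (funext fun y => h_eq _ ?_) fun h => hxa ?_).trans
    (card_sel_le_hammingNorm_epipodal hsel β j B r)
  · exact Nat.lt_succ_iff.1 (lt_min_iff.1 y.2).1
  · exact congrFun h ⟨x, lt_min (Nat.lt_succ_iff.2 hx) x.2⟩

theorem prob_hammingNorm_epipodal_selectiveOutput_lt_two_le [Fintype F]
    (hsel : IsMaxRedundantSetRule sel) {β : ℕ} (hβ : 7 ≤ β) (r : Fin k) {s : ℕ}
    (hn : k + (s + 2) * β ≤ n) :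
    prob (PMF.uniformOfFintype (Matrix (Fin k) (Fin n) F))
        {B | hammingNorm (epipodal (selectiveOutput sel β (r + 1 + s) B) r) < 2} ≤
      2 ^ (-(β : ℝ) / 20) + 2 ^ (-((β : ℝ) ^ 2) / (20 * (Fintype.card F : ℝ) ^ (r + 1 : ℕ))) := by
  have h_end : k + (s + 1) * β + β = k + (s + 2) * β := by ring
  let e : Fin β ↪ Fin n :=
    (Fin.natAddEmb (k + (s + 1) * β)).trans (Fin.castLEEmb (h_end.trans_le hn))
  let block (B : Matrix (Fin k) (Fin n) F) : Fin β → Fin (r + 1) → F :=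
    fun a x => (stageOperator sel β (r + 1) s B * B) (Fin.castLE r.2 x) (e a)
  have h_uniform := map_uniformOfFintype_mul_of_eqOn (isUnit_stageOperator sel β (r + 1) s)
    (fun B B' => stageOperator_eq_of_eqOn sel β (r + 1)) (Fin.castLEEmb r.2) e
    fun a => (Nat.le_add_right _ _).not_gt
  have h_cover : {B | hammingNorm (epipodal (selectiveOutput sel β (r + 1 + s) B) r) < 2} ⊆
      block ⁻¹' {v | Set.InjOn v (Function.support v)} := by
    intro B hB a ha b _ h_eq
    by_contra hab
    obtain ⟨x, hx⟩ := Function.ne_iff.1 ha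
    have h_lt (a : Fin β) : (e a : ℕ) < k + (s + 2) * β :=
      (Nat.add_lt_add_left a.2 _).trans_eq h_end
    rw [Set.mem_ofPred_eq, selectiveOutput_add] at hB
    exact hB.not_ge <| two_le_hammingNorm_epipodal_reduceLoop hsel β (h_lt a) (h_lt b)
      (e.injective.ne hab) (fun x hx => congrFun h_eq ⟨x, Nat.lt_succ_iff.2 hx⟩)
      ⟨Fin.castLE r.2 x, Nat.lt_succ_iff.1 x.2, hx⟩
  have h_birthday := prob_injOn_support_le (ι := Fin β) (V := Fin (r + 1) → F) (by simpa using hβ)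
  rw [Fintype.card_fun, Fintype.card_fin, Fintype.card_fin, ← h_uniform, prob_map] at h_birthday
  push_cast at h_birthday
  exact (prob_mono _ h_cover).trans h_birthday

theorem prob_exists_hammingNorm_epipodal_selectiveOutput_lt_two_le [Fintype F]
    (hsel : IsMaxRedundantSetRule sel) {β : ℕ} (hβ : 7 ≤ β) {t I : ℕ} (hI : I ≤ t)
    (hn : k + (t + 1) * β ≤ n) :
    prob (PMF.uniformOfFintype (Matrix (Fin k) (Fin n) F)) {B | ∃ r : Fin k, (r : ℕ) < I ∧
        hammingNorm (epipodal (selectiveOutput sel β t B) r) < 2} ≤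
      ∑ r ∈ Finset.range I, ((2 : ℝ) ^ (-(β : ℝ) / 20) +
        2 ^ (-((β : ℝ) ^ 2) / (20 * (Fintype.card F : ℝ) ^ (r + 1)))) := by
  let rows : Finset (Fin k) := Finset.univ.filter fun r => (r : ℕ) < I
  let light (r : Fin k) : Set (Matrix (Fin k) (Fin n) F) :=
    {B | hammingNorm (epipodal (selectiveOutput sel β t B) r) < 2}
  let bound (r : ℕ) : ℝ := 2 ^ (-(β : ℝ) / 20) +
    2 ^ (-((β : ℝ) ^ 2) / (20 * (Fintype.card F : ℝ) ^ (r + 1)))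
  have h_light (r : Fin k) (hr : r ∈ rows) :
      prob (PMF.uniformOfFintype _) (light r) ≤ bound r := by
    have hr_lt : (r : ℕ) < I := (Finset.mem_filter.1 hr).2
    obtain ⟨s, rfl⟩ := Nat.exists_eq_add_of_le (hr_lt.trans_le hI)
    have h_cols : (s + 2) * β ≤ (r + 1 + s + 1) * β := Nat.mul_le_mul_right β (by omega)
    exact prob_hammingNorm_epipodal_selectiveOutput_lt_two_le hsel hβ r
      ((Nat.add_le_add_left h_cols k).trans hn)
  have h_subset : rows.map Fin.valEmbedding ⊆ Finset.range I := by
    intro x hx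
    obtain ⟨r, hr, rfl⟩ := Finset.mem_map.1 hx
    exact Finset.mem_range.2 (Finset.mem_filter.1 hr).2
  calc prob (PMF.uniformOfFintype _) {B | ∃ r : Fin k, (r : ℕ) < I ∧ B ∈ light r}
      = prob (PMF.uniformOfFintype _) (⋃ r ∈ rows, light r) := by
        congr 1
        ext B
        simp only [rows, Set.mem_ofPred_eq, Set.mem_iUnion, Finset.mem_filter, Finset.mem_univ,
          true_and, exists_prop]
    _ ≤ ∑ r ∈ rows, bound r :=
        (prob_biUnion_finset_le _ _ _).trans (Finset.sum_le_sum h_light)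
    _ = ∑ r ∈ rows.map Fin.valEmbedding, bound r :=
        (Finset.sum_map rows Fin.valEmbedding bound).symm
    _ ≤ ∑ r ∈ Finset.range I, bound r :=
        Finset.sum_le_sum_of_subset_of_nonneg h_subset fun _ _ _ => by positivity

theorem one_sub_le_prob_forall_two_le_hammingNorm [Fintype F] (hsel : IsMaxRedundantSetRule sel)
    {β : ℕ} (hβ : 7 ≤ β) {I : ℕ} (hn : k + (I + 1) * β ≤ n) :
    1 - (((Fintype.card F : ℝ) ^ β)⁻¹ + ∑ r ∈ Finset.range I,
        ((2 : ℝ) ^ (-(β : ℝ) / 20) +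
          2 ^ (-((β : ℝ) ^ 2) / (20 * (Fintype.card F : ℝ) ^ (r + 1))))) ≤
      prob (PMF.uniformOfFintype (Matrix (Fin k) (Fin n) F))
        {B | ∃ B', selectiveBackwardReduction sel β B = some B' ∧
          ∀ i : Fin k, (i : ℕ) < I → 2 ≤ hammingNorm (epipodal B' i)} := by
  have h_iter : I + 1 ≤ (n - k) / β := (Nat.le_div_iff_mul_le (by omega)).2 (by omega)
  obtain ⟨t, ht⟩ : ∃ t, (n - k) / β = t + 1 :=
    Nat.exists_eq_add_of_le' (le_trans I.succ_pos h_iter)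
  have h_cover : {B | ∃ B', selectiveBackwardReduction sel β B = some B' ∧
      ∀ i : Fin k, (i : ℕ) < I → 2 ≤ hammingNorm (epipodal B' i)}ᶜ ⊆
      {B : Matrix (Fin k) (Fin n) F | ¬ LeadingColsSpan (k + β) B} ∪
        {B | ∃ r : Fin k, (r : ℕ) < I ∧
          hammingNorm (epipodal (selectiveOutput sel β t B) r) < 2} := by
    intro B hB
    by_contra! h
    rw [Set.mem_union, not_or, Set.mem_ofPred_eq, not_not] at h
    refine hB ⟨_, h.1.selectiveBackwardReduction_eq_some sel β, fun i hi => ?_⟩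
    rw [ht]
    exact not_lt.1 fun h_lt => h.2 ⟨i, hi, h_lt⟩
  refine le_trans (sub_le_sub_left ?_ 1) (one_sub_prob_le_of_compl_subset _ h_cover)
  refine (prob_union_le _ _ _).trans (add_le_add ?_ ?_)
  · exact prob_not_leadingColsSpan_le (le_trans (by nlinarith) hn)
  · have h_cols := Nat.div_mul_le_self (n - k) β
    rw [ht] at h_cols h_iter
    exact prob_exists_hammingNorm_epipodal_selectiveOutput_lt_two_le hsel hβ
      (Nat.le_of_succ_le_succ h_iter) (by omega)

end FailureProbability

section FailureBound

theorem one_le_logb_two_div {ε : ℝ} (hε0 : 0 < ε) (hε1 : ε < 1) : 1 ≤ Real.logb 2 (2 / ε) := by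
  rw [Real.le_logb_iff_rpow_le (by norm_num) (by positivity), Real.rpow_one, le_div_iff₀ hε0]
  linarith

theorem inv_pow_le_logb_mul {q : ℝ} (hq : 2 ≤ q) {β : ℕ} (hβ : 2 ≤ β) :
    (q ^ β)⁻¹ ≤ Real.logb q 20 * 2 ^ (-(β : ℝ) / 20) := by
  obtain ⟨b, rfl⟩ : ∃ b, β = b + 1 := ⟨β - 1, by omega⟩
  have h_log : q⁻¹ ≤ Real.logb q 20 := by
    have h_num : 1 ≤ Real.log 20 := by
      rw [Real.le_log_iff_exp_le (by norm_num)]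
      linarith [Real.exp_one_lt_d9]
    have h_pos : 0 < Real.log q := Real.log_pos (by linarith)
    rw [Real.logb, inv_eq_one_div]
    gcongr
    exact Real.log_le_self (by linarith)
  have h_pow : (q ^ b)⁻¹ ≤ 2 ^ (-((b + 1 : ℕ) : ℝ) / 20) :=
    calc (q ^ b)⁻¹ ≤ (2 ^ b)⁻¹ := by gcongr
      _ = (2 : ℝ) ^ (-(b : ℝ)) := by rw [Real.rpow_neg (by norm_num), Real.rpow_natCast]
      _ ≤ 2 ^ (-((b + 1 : ℕ) : ℝ) / 20) := by
        have hb : (1 : ℝ) ≤ b := mod_cast Nat.le_of_succ_le_succ hβ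
        refine Real.rpow_le_rpow_of_exponent_le (by norm_num) ?_
        push_cast
        linarith
  rw [pow_succ', mul_inv]
  gcongr
  exact (inv_nonneg.2 (by linarith)).trans h_log

theorem sum_range_pow_sub_le {x : ℝ} (hx0 : 0 ≤ x) (hx1 : x ≤ 1 / 2) (I : ℕ) :
    ∑ r ∈ Finset.range I, x ^ (I - r) ≤ 2 * x := by
  induction I with
  | zero => simpa using hx0
  | succ I ih =>
    have h_shift : ∑ r ∈ Finset.range I, x ^ (I + 1 - r) =
        x * ∑ r ∈ Finset.range I, x ^ (I - r) := by
      rw [Finset.mul_sum]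
      refine Finset.sum_congr rfl fun r hr => ?_
      rw [Nat.succ_sub (Finset.mem_range.1 hr).le, pow_succ']
    rw [Finset.sum_range_succ, h_shift, Nat.add_sub_cancel_left, pow_one]
    nlinarith

theorem two_rpow_neg_sq_div_le {q I r : ℕ} (hq : 2 ≤ q) {b L : ℝ} (hL : 0 ≤ L)
    (hI : (q : ℝ) ^ I * (20 * L) ≤ b ^ 2) (hr : r < I) :
    (2 : ℝ) ^ (-(b ^ 2) / (20 * (q : ℝ) ^ (r + 1))) ≤ (2 ^ (-L)) ^ (I - r) := by
  obtain ⟨d, rfl⟩ := Nat.exists_eq_add_of_lt hr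
  have h_exp : L * (d + 1) * (20 * (q : ℝ) ^ (r + 1)) ≤ b ^ 2 :=
    calc L * (d + 1) * (20 * (q : ℝ) ^ (r + 1)) ≤ L * (q : ℝ) ^ d * (20 * (q : ℝ) ^ (r + 1)) := by
          gcongr
          exact_mod_cast Nat.lt_pow_self hq
      _ = (q : ℝ) ^ (r + d + 1) * (20 * L) := by ring
      _ ≤ b ^ 2 := hI
  have : (0 : ℝ) < q := Nat.cast_pos.2 (by omega)
  rw [← Real.rpow_mul_natCast (by norm_num), show r + d + 1 - r = d + 1 by omega]
  refine Real.rpow_le_rpow_of_exponent_le (by norm_num) ?_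
  rw [neg_div, neg_mul, neg_le_neg_iff, le_div_iff₀ (by positivity)]
  exact_mod_cast h_exp

theorem sum_two_rpow_neg_sq_div_le {q : ℕ} (hq : 2 ≤ q) {b ε : ℝ} (hε0 : 0 < ε) (hε1 : ε < 1)
    {I : ℕ} (hI : (q : ℝ) ^ I * (20 * Real.logb 2 (2 / ε)) ≤ b ^ 2) :
    ∑ r ∈ Finset.range I, (2 : ℝ) ^ (-(b ^ 2) / (20 * (q : ℝ) ^ (r + 1))) ≤ ε := by
  have hL : 0 ≤ Real.logb 2 (2 / ε) := zero_le_one.trans (one_le_logb_two_div hε0 hε1)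
  have h_base : (2 : ℝ) ^ (-Real.logb 2 (2 / ε)) = ε / 2 := by
    rw [Real.rpow_neg (by norm_num), Real.rpow_logb (by norm_num) (by norm_num) (by positivity),
      inv_div]
  calc ∑ r ∈ Finset.range I, (2 : ℝ) ^ (-(b ^ 2) / (20 * (q : ℝ) ^ (r + 1)))
      ≤ ∑ r ∈ Finset.range I, (ε / 2) ^ (I - r) := Finset.sum_le_sum fun r hr =>
        h_base ▸ two_rpow_neg_sq_div_le hq hL hI (Finset.mem_range.1 hr)
    _ ≤ 2 * (ε / 2) := sum_range_pow_sub_le (by linarith) (by linarith) I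
    _ = ε := by ring

theorem pow_mul_le_sq {q x y : ℝ} (hq : 1 < q) (hx : 0 < x) (hy : 0 < y) {I : ℕ}
    (hI : (I : ℝ) ≤ 2 * Real.logb q x - Real.logb q y) : q ^ I * y ≤ x ^ 2 := by
  rw [← Real.logb_le_logb hq (by positivity) (by positivity),
    Real.logb_mul (by positivity) hy.ne', Real.logb_pow, Real.logb_pow,
    Real.logb_self_eq_one hq, mul_one, Nat.cast_ofNat]
  linarith

theorem inv_pow_add_mul_le {q : ℝ} (hq : 2 ≤ q) {β : ℕ} (hβ : 2 ≤ β) {x : ℝ}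
    (hx : x ≤ 2 * Real.logb q β - Real.logb q 20) :
    (q ^ β)⁻¹ + x * 2 ^ (-(β : ℝ) / 20) ≤ Real.logb q β * 2 ^ (1 - (β : ℝ) / 20) :=
  calc (q ^ β)⁻¹ + x * 2 ^ (-(β : ℝ) / 20)
      ≤ Real.logb q 20 * 2 ^ (-(β : ℝ) / 20) +
          (2 * Real.logb q β - Real.logb q 20) * 2 ^ (-(β : ℝ) / 20) := by
        gcongr
        exact inv_pow_le_logb_mul hq hβ
    _ = Real.logb q β * (2 ^ (1 : ℝ) * 2 ^ (-(β : ℝ) / 20)) := by rw [Real.rpow_one]; ring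
    _ = Real.logb q β * 2 ^ (1 - (β : ℝ) / 20) := by
        rw [← Real.rpow_add (by norm_num), neg_div, ← sub_eq_add_neg]

theorem inv_pow_add_sum_range_floor_le {q : ℕ} (hq : 2 ≤ q) {β : ℕ} (hβ : 7 ≤ β) {ε : ℝ}
    (hε0 : 0 < ε) (hε1 : ε < 1) :
    ((q : ℝ) ^ β)⁻¹ + ∑ r ∈ Finset.range
        ⌊2 * Real.logb q β - Real.logb q (20 * Real.logb 2 (2 / ε))⌋₊,
          ((2 : ℝ) ^ (-(β : ℝ) / 20) + 2 ^ (-((β : ℝ) ^ 2) / (20 * (q : ℝ) ^ (r + 1)))) ≤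
      Real.logb q β * 2 ^ (1 - (β : ℝ) / 20) + ε := by
  have hq' : (2 : ℝ) ≤ q := mod_cast hq
  have hβ' : (7 : ℝ) ≤ β := mod_cast hβ
  have hL := one_le_logb_two_div hε0 hε1
  set L := Real.logb 2 (2 / ε)
  set X := 2 * Real.logb q β - Real.logb q (20 * L)
  have h_log : Real.logb q 20 ≤ Real.logb q (20 * L) :=
    Real.logb_le_logb_of_le (by linarith) (by norm_num) (by linarith)
  have h_twenty : Real.logb q 20 ≤ 2 * Real.logb q β :=
    calc Real.logb q 20 ≤ Real.logb q ((β : ℝ) ^ 2) :=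
          Real.logb_le_logb_of_le (by linarith) (by norm_num) (by nlinarith)
      _ = 2 * Real.logb q β := by rw [Real.logb_pow, Nat.cast_ofNat]
  have h_rows : (⌊X⌋₊ : ℝ) ≤ 2 * Real.logb q β - Real.logb q 20 :=
    (Nat.cast_le.2 (Nat.floor_mono (sub_le_sub_left h_log _))).trans
      (Nat.floor_le (sub_nonneg.2 h_twenty))
  have h_collision : ∑ r ∈ Finset.range ⌊X⌋₊,
      (2 : ℝ) ^ (-((β : ℝ) ^ 2) / (20 * (q : ℝ) ^ (r + 1))) ≤ ε := by
    rcases lt_or_ge X 0 with h | h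
    · rw [Nat.floor_of_nonpos h.le, Finset.sum_range_zero]
      exact hε0.le
    · exact sum_two_rpow_neg_sq_div_le hq hε0 hε1
        (pow_mul_le_sq (by linarith) (by linarith) (by linarith) (Nat.floor_le h))
  rw [Finset.sum_add_distrib, Finset.sum_const, Finset.card_range, nsmul_eq_mul, ← add_assoc]
  exact add_le_add (inv_pow_add_mul_le hq' (by omega) h_rows) h_collision

theorem add_floor_succ_mul_le {q k n β : ℕ} (hq : 2 ≤ q) (hβ : 1 ≤ β)
    (hβn : (k : ℝ) + β * (2 * Real.logb q β + 1) ≤ n) {ε : ℝ} (hε0 : 0 < ε) (hε1 : ε < 1) :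
    k + (⌊2 * Real.logb q β - Real.logb q (20 * Real.logb 2 (2 / ε))⌋₊ + 1) * β ≤ n := by
  have hq' : (1 : ℝ) < q := Nat.one_lt_cast.2 hq
  have hL := one_le_logb_two_div hε0 hε1
  have h_log : 0 ≤ Real.logb q β := Real.logb_nonneg hq' (Nat.one_le_cast.2 hβ)
  have h_floor : (⌊2 * Real.logb q β - Real.logb q (20 * Real.logb 2 (2 / ε))⌋₊ : ℝ) ≤
      2 * Real.logb q β :=
    (Nat.cast_le.2 (Nat.floor_mono (sub_le_self _ (Real.logb_nonneg hq' (by linarith))))).trans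
      (Nat.floor_le (by linarith))
  rw [← Nat.cast_le (α := ℝ)]
  push_cast
  nlinarith [mul_le_mul_of_nonneg_right h_floor β.cast_nonneg]

theorem add_mul_two_logb_le {q k n β : ℕ} (hq : 2 ≤ q) (hkn : k ≤ n) (hdvd : β ∣ n - k)
    (hβ : 1 ≤ β)
    (hβn : (β : ℝ) ≤ ((n : ℝ) - k) / (2 * Real.logb q ((n : ℝ) - k) + 1)) :
    (k : ℝ) + β * (2 * Real.logb q β + 1) ≤ n := by
  have hq' : (1 : ℝ) < q := Nat.one_lt_cast.2 hq
  have hβ' : (1 : ℝ) ≤ β := Nat.one_le_cast.2 hβ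
  have h_ne : n - k ≠ 0 := by
    intro h
    rw [← Nat.cast_sub hkn, h, Nat.cast_zero, zero_div] at hβn
    linarith
  have h_le : (β : ℝ) ≤ n - k := by
    rw [← Nat.cast_sub hkn]
    exact_mod_cast Nat.le_of_dvd (Nat.pos_of_ne_zero h_ne) hdvd
  have h_log : Real.logb q β ≤ Real.logb q ((n : ℝ) - k) :=
    Real.logb_le_logb_of_le hq' (by linarith) h_le
  have h_log_nonneg : 0 ≤ Real.logb q β := Real.logb_nonneg hq' (by linarith)
  rw [le_div_iff₀ (by linarith)] at hβn
  nlinarith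

end FailureBound

end CodeReduction

theorem mainTheorem3_general {F : Type*} [Field F] [Fintype F] [DecidableEq F]
    (sel : ∀ k n : ℕ, Matrix (Fin k) (Fin n) F → Finset (Fin n))
    (hsel : CodeReduction.IsMaxRedundantSetRule sel)
    (q k n β : ℕ) (hq : q = Fintype.card F) (hβ : 7 ≤ β)
    (hβn : (k : ℝ) + β * (2 * Real.logb q β + 1) ≤ n)
    (ε : ℝ) (hε0 : 0 < ε) (hε1 : ε < 1) :
    1 - Real.logb q β * (2 : ℝ) ^ (1 - (β : ℝ) / 20) - ε ≤
      ((PMF.uniformOfFintype (Matrix (Fin k) (Fin n) F)).toOuterMeasure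
        {B | ∃ B', CodeReduction.selectiveBackwardReduction sel β B = some B' ∧
          ∀ i : Fin k,
            ((i : ℕ) : ℝ) + 1 ≤
              2 * Real.logb q β - Real.logb q (20 * Real.logb 2 (2 / ε)) →
            2 ≤ hammingNorm (CodeReduction.epipodal B' i)}).toReal := by
  have hq2 : 2 ≤ q := hq ▸ Fintype.one_lt_card
  have h_bound := CodeReduction.inv_pow_add_sum_range_floor_le hq2 hβ hε0 hε1
  have h_cols := CodeReduction.add_floor_succ_mul_le hq2 (by omega) hβn hε0 hε1
  subst hq
  have h_rows := CodeReduction.one_sub_le_prob_forall_two_le_hammingNorm hsel hβ h_cols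
  refine le_trans (by linarith) (h_rows.trans (CodeReduction.prob_mono _ ?_))
  rintro B ⟨B', h_output, h_weight⟩
  exact ⟨B', h_output, fun i hi => h_weight i (Nat.le_floor (mod_cast hi))⟩

theorem mainTheorem3 {F : Type*} [Field F] [Fintype F] [DecidableEq F]
    (sel : ∀ k n : ℕ, Matrix (Fin k) (Fin n) F → Finset (Fin n))
    (hsel : CodeReduction.IsMaxRedundantSetRule sel)
    (q k n β : ℕ) (hq : q = Fintype.card F) (hkn : k ≤ n) (hdvd : β ∣ n - k)
    (hβ : 7 ≤ β)
    (hβn : (β : ℝ) ≤ ((n : ℝ) - k) / (2 * Real.logb q ((n : ℝ) - k) + 1))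
    (ε : ℝ) (hε0 : 0 < ε) (hε1 : ε < 1) :
    1 - Real.logb q β * (2 : ℝ) ^ (1 - (β : ℝ) / 20) - ε ≤
      ((PMF.uniformOfFintype (Matrix (Fin k) (Fin n) F)).toOuterMeasure
        {B | ∃ B', CodeReduction.selectiveBackwardReduction sel β B = some B' ∧
          ∀ i : Fin k,
            ((i : ℕ) : ℝ) + 1 ≤
              2 * Real.logb q β - Real.logb q (20 * Real.logb 2 (2 / ε)) →
            2 ≤ hammingNorm (CodeReduction.epipodal B' i)}).toReal :=
  mainTheorem3_general sel hsel q k n β hq hβ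
    (CodeReduction.add_mul_two_logb_le (hq ▸ Fintype.one_lt_card) hkn hdvd (by omega) hβn) ε hε0 hε1
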